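/- Let $\overline{\mathbb C}=\mathbb C\cup\{\infty\}$ carry the chordal metric $d(z,w)=|z-w|\,(1+|z|^2)^{-1/2}(1+|w|^2)^{-1/2}$ (extended to $\infty$ by continuity), and let the nonempty compact subsets of $\overline{\mathbb C}$ carry the corresponding Hausdorff metric. Let $\varphi:\mathbb C\to\mathbb R$ be continuous on $\mathbb C\setminus e$ for some finite set $e\subset\mathbb C$; nothing is assumed about the behaviour of $\varphi$ near $e$ or near $\infty$. For a nonempty compact $\Gamma\subset\overline{\mathbb C}$ let $\mathcal M(\Gamma,\varphi)$ be the set of Borel probability measures $\mu$ supported on $\Gamma$ such that $\int\log(1+|x|)\,d\mu(x)<\infty$ (so $\mu(\{\infty\})=0$), $\mathcal E(\mu)=\iint\log\frac1{|x-y|}\,d\mu(x)\,d\mu(y)<\infty$ and $\varphi\in L^1(\mu)$. Put $$\mathcal E_\varphi(\mu)=\mathcal E(\mu)+2\int\varphi\,d\mu,\qquad \mathcal E_\varphi[\Gamma]=\inf_{\mu\in\mathcal M(\Gamma,\varphi)}\mathcal E_\varphi(\mu)\in[-\infty,+\infty],$$ where the infimum over the empty set is $+\infty$. **Theorem 3.2.**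 Let $s\in\mathbb N$ and let $\mathcal T$ be any class of nonempty compact subsets of $\overline{\mathbb C}$, each of which has at most $s$ connected components. Then the functional $\mathcal E_\varphi:\mathcal T\to[-\infty,+\infty]$, $\Gamma\mapsto\mathcal E_\varphi[\Gamma]$, is upper semicontinuous with respect to the Hausdorff metric. -/

import Mathlib

open MeasureTheory
open scoped ENNReal

noncomputable section

/-! ### The extended plane with the chordal metric -/

/-- The extended complex plane `ℂ ∪ {∞}`. It is a synonym of `OnePoint ℂ` that carries the chordal
metric (and the topology of that metric). -/
def ExtendedPlane : Type := OnePoint ℂ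

namespace ExtendedPlane

/-- The inclusion of the open plane. -/
def ofComplex (z : ℂ) : ExtendedPlane := OnePoint.some z

/-- The chordal distance `|z - w| (1 + |z|²)^(-1/2) (1 + |w|²)^(-1/2)`, extended to `∞` by
continuity. -/
def chordalDist : ExtendedPlane → ExtendedPlane → ℝ
  | OnePoint.some z, OnePoint.some w =>
      ‖z - w‖ / (Real.sqrt (1 + ‖z‖ ^ 2) * Real.sqrt (1 + ‖w‖ ^ 2))
  | OnePoint.some z, OnePoint.infty => 1 / Real.sqrt (1 + ‖z‖ ^ 2)
  | OnePoint.infty, OnePoint.some w => 1 / Real.sqrt (1 + ‖w‖ ^ 2)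
  | OnePoint.infty, OnePoint.infty => 0

/-- The point `(z, 1)` of `ℂ × ℝ` with the Euclidean norm. -/
def lift (z : ℂ) : WithLp 2 (ℂ × ℝ) := WithLp.toLp 2 (z, 1)

theorem norm_lift (z : ℂ) : ‖lift z‖ = Real.sqrt (1 + ‖z‖ ^ 2) := by
  rw [WithLp.prod_norm_eq_of_L2]
  simp [lift, add_comm]

theorem norm_lift_sub (z w : ℂ) : ‖lift z - lift w‖ = ‖z - w‖ := by
  rw [WithLp.prod_norm_eq_of_L2]
  simp [lift]

theorem lift_ne_zero (z : ℂ) : lift z ≠ 0 := by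
  rw [← norm_pos_iff, norm_lift]
  positivity

/-- Stereographic projection, in the form of the inversion of `(z, 1)` in the unit sphere:
the chordal distance is the Euclidean distance of the images. -/
def stereo : ExtendedPlane → WithLp 2 (ℂ × ℝ)
  | OnePoint.some z => (1 / ‖lift z‖) ^ 2 • lift z
  | OnePoint.infty => 0

theorem dist_stereo (x y : ExtendedPlane) : dist (stereo x) (stereo y) = chordalDist x y := by
  have key : ∀ z : ℂ, ‖(1 / ‖lift z‖) ^ 2 • lift z‖ = 1 / ‖lift z‖ := by
    intro z
    have h : ‖lift z‖ ≠ 0 := norm_ne_zero_iff.2 (lift_ne_zero z)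
    rw [norm_smul, Real.norm_of_nonneg (by positivity)]
    field_simp
  match x, y with
  | OnePoint.some z, OnePoint.some w =>
    simp only [stereo, chordalDist]
    rw [dist_div_norm_sq_smul (lift_ne_zero z) (lift_ne_zero w), dist_eq_norm, norm_lift_sub,
      norm_lift, norm_lift]
    ring
  | OnePoint.some z, OnePoint.infty =>
    simp only [stereo, chordalDist]
    rw [dist_zero_right, key, norm_lift]
  | OnePoint.infty, OnePoint.some w =>
    simp only [stereo, chordalDist]
    rw [dist_zero_left, key, norm_lift]
  | OnePoint.infty, OnePoint.infty => simp [stereo, chordalDist]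

theorem eq_of_chordalDist_eq_zero : ∀ x y : ExtendedPlane, chordalDist x y = 0 → x = y
  | OnePoint.some z, OnePoint.some w, h => by
    have h1 : Real.sqrt (1 + ‖z‖ ^ 2) * Real.sqrt (1 + ‖w‖ ^ 2) ≠ 0 := by positivity
    have h2 : ‖z - w‖ = 0 := (div_eq_zero_iff.1 h).resolve_right h1
    rw [sub_eq_zero.1 (norm_eq_zero.1 h2)]
  | OnePoint.some z, OnePoint.infty, h => by
    have h1 : 1 / Real.sqrt (1 + ‖z‖ ^ 2) ≠ 0 := by positivity
    exact absurd h h1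
  | OnePoint.infty, OnePoint.some w, h => by
    have h1 : 1 / Real.sqrt (1 + ‖w‖ ^ 2) ≠ 0 := by positivity
    exact absurd h h1
  | OnePoint.infty, OnePoint.infty, _ => rfl

/-- The chordal metric. Consequently `TopologicalSpace.NonemptyCompacts ExtendedPlane` carries
the corresponding Hausdorff metric. -/
instance instMetricSpace : MetricSpace ExtendedPlane where
  dist := chordalDist
  dist_self x := by rw [← dist_stereo, dist_self]
  dist_comm x y := by rw [← dist_stereo, ← dist_stereo, dist_comm]
  dist_triangle x y z := by
    rw [← dist_stereo, ← dist_stereo, ← dist_stereo]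
    exact dist_triangle _ _ _
  eq_of_dist_eq_zero := eq_of_chordalDist_eq_zero _ _

end ExtendedPlane

/-- The number `s(K)` of connected components of a compact set, with value `⊤` if there are
infinitely many. -/
def numComponents (K : TopologicalSpace.NonemptyCompacts ExtendedPlane) : ℕ∞ :=
  ENat.card (ConnectedComponents (K : Set ExtendedPlane))

/-! ### Logarithmic energy in an external field -/

/-- The logarithmic kernel `log (1 / |x - y|)`, with value `⊤` on the diagonal. -/
def logKernel (x y : ℂ) : EReal := ENNReal.log (‖x - y‖ₑ)⁻¹

/-- The logarithmic energy `∬ log (1 / |x - y|) dμ(x) dμ(y)`, as the integral of the positive part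
minus the integral of the negative part. If `log (1 + |x|)` is `μ`-integrable and `μ` is finite
then the second integral is finite, so the energy is a well defined element of `(-∞, ∞]`. -/
def logEnergy (μ : Measure ℂ) : EReal :=
  ((∫⁻ p, (logKernel p.1 p.2).toENNReal ∂(μ.prod μ) : ℝ≥0∞) : EReal) -
    ((∫⁻ p, (-logKernel p.1 p.2).toENNReal ∂(μ.prod μ) : ℝ≥0∞) : EReal)

/-- The class `𝓜(K, φ)` of competing measures: Borel probability measures carried by the compact
set `K` that satisfy `∫ log (1 + |x|) dμ < ∞`, have finite logarithmic energy and make the external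
field `φ` integrable. As the logarithmic condition forbids a mass at `∞`, the measures live on the
open plane `ℂ`; this does not prevent `∞ ∈ K`, nor an unbounded support. -/
structure IsCompeting (K : TopologicalSpace.NonemptyCompacts ExtendedPlane) (φ : ℂ → ℝ)
    (μ : Measure ℂ) : Prop where
  isProbabilityMeasure : IsProbabilityMeasure μ
  carried : ∀ᵐ x ∂μ, ExtendedPlane.ofComplex x ∈ K
  integrable_log : Integrable (fun x : ℂ => Real.log (1 + ‖x‖)) μ
  energy_lt_top : logEnergy μ < ⊤
  integrable_field : Integrable φ μ

/-- The weighted energy `𝓔_φ(μ) = ∬ log (1 / |x - y|) dμ(x) dμ(y) + 2 ∫ φ dμ`. -/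
def weightedEnergy (φ : ℂ → ℝ) (μ : Measure ℂ) : EReal :=
  logEnergy μ + ((2 * ∫ x, φ x ∂μ : ℝ) : EReal)

/-- The equilibrium energy `𝓔_φ[K] = inf {𝓔_φ(μ) : μ ∈ 𝓜(K, φ)}` in `[-∞, ∞]`; the infimum over
the empty class is `⊤`. -/
def equilibriumEnergy (φ : ℂ → ℝ) (K : TopologicalSpace.NonemptyCompacts ExtendedPlane) : EReal :=
  ⨅ (μ : Measure ℂ) (_ : IsCompeting K φ μ), weightedEnergy φ μ

end

open MeasureTheory Filter Topology
open scoped ENNReal ProbabilityTheory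

noncomputable section

/-! ### The energy as a real integral -/

/-! Fix a competitor `μ` for `Γ` with weighted energy below the given bound. For every `Γ'` in the
class close to `Γ`, a competitor for `Γ'` is built whose energy is only slightly larger than that of
`μ`.

Finite energy makes the diagonal null for `μ.prod μ`, so tubes around it have small mass and the
finite set `e` is `μ`-null. Up to little mass, `μ` lives on a compact `K` off `e`, near which the
field is uniformly continuous. Each point of `K ∩ Γ` has a point `z` of `Γ'` nearby. Call `z` good
if all circles around it of radius at most `ρ` meet `Γ'`. A component of `Γ'` containing a bad point
lies in a disc of radius `ρ`, so the mass near the bad points of one component has square at most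
the mass of a thin tube. With at most `s` components the total loss is small, uniformly in `Γ'`
(`measure_near_not_meetsCircles_le`).

Condition `μ` on the remaining set and smear each point along a measurable, possibly discontinuous,
curve `g` in `Γ'` with `‖g t - z‖ = ρ * t`. Distant pairs hardly notice this. For close pairs, the
reverse triangle inequality bounds the smeared kernel by a one-dimensional logarithmic integral, and
such pairs have little mass (`lintegral_shiftedKernel_spread_prod_le`). `exists_energy_cond_lt`
controls the conditioning, and `equilibriumEnergy_le_of_curves` assembles the energy estimate. -/

/-- The real valued logarithmic kernel `log (1 / |x - y|)`, with the value `0` on the diagonal. -/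
def realKernel (p : ℂ × ℂ) : ℝ := -Real.log ‖p.1 - p.2‖

theorem measurable_realKernel : Measurable realKernel := by
  unfold realKernel
  fun_prop

theorem measurableSet_diagonal_complex : MeasurableSet {p : ℂ × ℂ | p.1 = p.2} :=
  measurableSet_eq_fun measurable_fst measurable_snd

theorem logKernel_self (x : ℂ) : logKernel x x = ⊤ := by
  simp [logKernel]

theorem logKernel_of_ne {x y : ℂ} (h : x ≠ y) : logKernel x y = (realKernel (x, y) : EReal) := by
  have h1 : 0 < ‖x - y‖ := norm_pos_iff.2 (sub_ne_zero.2 h)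
  rw [logKernel, ← ofReal_norm, ← ENNReal.ofReal_inv_of_pos h1,
    ENNReal.log_ofReal_of_pos (by positivity), Real.log_inv]
  rfl

theorem toENNReal_logKernel_of_ne {x y : ℂ} (h : x ≠ y) :
    (logKernel x y).toENNReal = ENNReal.ofReal (realKernel (x, y)) := by
  rw [logKernel_of_ne h, EReal.toENNReal_of_ne_top (EReal.coe_ne_top _), EReal.toReal_coe]

theorem toENNReal_neg_logKernel (x y : ℂ) :
    (-logKernel x y).toENNReal = ENNReal.ofReal (-realKernel (x, y)) := by
  by_cases h : x = y
  · subst h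
    simp [logKernel_self, realKernel]
  · rw [logKernel_of_ne h, ← EReal.coe_neg, EReal.toENNReal_of_ne_top (EReal.coe_ne_top _),
      EReal.toReal_coe]

/-- The diagonal must be null because there `logKernel` is `⊤` while `realKernel` is `0`, by the
convention `Real.log 0 = 0`. -/
theorem logEnergy_eq_integral {μ : Measure ℂ} (hd : (μ.prod μ) {p : ℂ × ℂ | p.1 = p.2} = 0)
    (hi : Integrable realKernel (μ.prod μ)) :
    logEnergy μ = ((∫ p, realKernel p ∂(μ.prod μ) : ℝ) : EReal) := by
  have hne : ∀ᵐ p ∂(μ.prod μ), p.1 ≠ p.2 := by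
    rw [ae_iff]
    simpa using hd
  have h1 : ∫⁻ p, (logKernel p.1 p.2).toENNReal ∂(μ.prod μ) =
      ∫⁻ p, ENNReal.ofReal (realKernel p) ∂(μ.prod μ) :=
    lintegral_congr_ae (hne.mono fun p hp => toENNReal_logKernel_of_ne hp)
  have h2 : ∫⁻ p, (-logKernel p.1 p.2).toENNReal ∂(μ.prod μ) =
      ∫⁻ p, ENNReal.ofReal (-realKernel p) ∂(μ.prod μ) :=
    lintegral_congr fun p => toENNReal_neg_logKernel _ _
  have f1 : ∫⁻ p, ENNReal.ofReal (realKernel p) ∂(μ.prod μ) ≠ ⊤ := hi.lintegral_lt_top.ne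
  have f2 : ∫⁻ p, ENNReal.ofReal (-realKernel p) ∂(μ.prod μ) ≠ ⊤ := hi.neg.lintegral_lt_top.ne
  rw [logEnergy, h1, h2, integral_eq_lintegral_pos_part_sub_lintegral_neg_part hi, EReal.coe_sub,
    EReal.coe_ennreal_toReal f1, EReal.coe_ennreal_toReal f2]

theorem neg_realKernel_le (p : ℂ × ℂ) :
    -realKernel p ≤ Real.log (1 + ‖p.1‖) + Real.log (1 + ‖p.2‖) := by
  have a1 := norm_nonneg p.1
  have a2 := norm_nonneg p.2
  rw [realKernel, neg_neg, ← Real.log_mul (by positivity) (by positivity)]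
  rcases (norm_nonneg (p.1 - p.2)).eq_or_lt with h | h
  · rw [← h, Real.log_zero]
    exact Real.log_nonneg (by nlinarith)
  · refine Real.log_le_log h ((norm_sub_le _ _).trans ?_)
    nlinarith

theorem lintegral_neg_realKernel_lt_top {μ : Measure ℂ} [IsProbabilityMeasure μ]
    (hl : Integrable (fun x : ℂ => Real.log (1 + ‖x‖)) μ) :
    ∫⁻ p, ENNReal.ofReal (-realKernel p) ∂(μ.prod μ) < ⊤ :=
  lt_of_le_of_lt (lintegral_mono fun p => ENNReal.ofReal_le_ofReal (neg_realKernel_le p))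
    ((hl.comp_fst μ).add (hl.comp_snd μ)).lintegral_lt_top

theorem lintegral_logKernel_lt_top {μ : Measure ℂ} [IsProbabilityMeasure μ]
    (hl : Integrable (fun x : ℂ => Real.log (1 + ‖x‖)) μ) (he : logEnergy μ < ⊤) :
    ∫⁻ p, (logKernel p.1 p.2).toENNReal ∂(μ.prod μ) < ⊤ := by
  have hN := lintegral_neg_realKernel_lt_top hl
  rw [lt_top_iff_ne_top]
  intro hP
  have h2 : ∫⁻ p, (-logKernel p.1 p.2).toENNReal ∂(μ.prod μ) =
      ∫⁻ p, ENNReal.ofReal (-realKernel p) ∂(μ.prod μ) :=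
    lintegral_congr fun p => toENNReal_neg_logKernel _ _
  rw [logEnergy, hP, h2, ← ENNReal.ofReal_toReal hN.ne] at he
  rw [EReal.coe_ennreal_top, EReal.coe_ennreal_ofReal, EReal.top_sub_coe] at he
  exact lt_irrefl _ he

theorem prod_diagonal_eq_zero {μ : Measure ℂ} [IsProbabilityMeasure μ]
    (hl : Integrable (fun x : ℂ => Real.log (1 + ‖x‖)) μ) (he : logEnergy μ < ⊤) :
    (μ.prod μ) {p : ℂ × ℂ | p.1 = p.2} = 0 := by
  have hP := lintegral_logKernel_lt_top hl he
  by_contra h0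
  refine hP.ne (top_unique ?_)
  calc (⊤ : ℝ≥0∞) = ∫⁻ p in {p : ℂ × ℂ | p.1 = p.2}, ⊤ ∂(μ.prod μ) := by
        rw [setLIntegral_const, ENNReal.top_mul h0]
    _ = ∫⁻ p in {p : ℂ × ℂ | p.1 = p.2}, (logKernel p.1 p.2).toENNReal ∂(μ.prod μ) := by
        refine setLIntegral_congr_fun measurableSet_diagonal_complex fun p hp => ?_
        have : p.1 = p.2 := hp
        simp [this, logKernel_self]
    _ ≤ _ := setLIntegral_le_lintegral _ _

theorem integrable_realKernel {μ : Measure ℂ} [IsProbabilityMeasure μ]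
    (hl : Integrable (fun x : ℂ => Real.log (1 + ‖x‖)) μ) (he : logEnergy μ < ⊤) :
    Integrable realKernel (μ.prod μ) := by
  have hP := lintegral_logKernel_lt_top hl he
  have hN := lintegral_neg_realKernel_lt_top hl
  have hle : ∫⁻ p, ENNReal.ofReal (realKernel p) ∂(μ.prod μ) < ⊤ := by
    refine lt_of_le_of_lt (lintegral_mono fun p => ?_) hP
    by_cases h : p.1 = p.2
    · simp [h, logKernel_self]
    · rw [toENNReal_logKernel_of_ne h]
  refine ⟨measurable_realKernel.aestronglyMeasurable, ?_⟩
  rw [hasFiniteIntegral_iff_norm]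
  calc ∫⁻ p, ENNReal.ofReal ‖realKernel p‖ ∂(μ.prod μ)
      ≤ ∫⁻ p, (ENNReal.ofReal (realKernel p) + ENNReal.ofReal (-realKernel p)) ∂(μ.prod μ) := by
        refine lintegral_mono fun p => ?_
        rcases le_total 0 (realKernel p) with h | h
        · rw [Real.norm_of_nonneg h]
          exact le_self_add
        · rw [Real.norm_of_nonpos h]
          exact le_add_self
    _ < ⊤ := by
        rw [lintegral_add_left (by have := measurable_realKernel; fun_prop)]
        exact ENNReal.add_lt_top.2 ⟨hle, hN⟩

/-! ### The shifted nonnegative kernel -/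

/-- The kernel `log (D / r)`, truncated below at `0`, with the value `⊤` at `r = 0`. -/
def shiftedKernel (D r : ℝ) : ℝ≥0∞ :=
  if r = 0 then ⊤ else ENNReal.ofReal (Real.log D - Real.log r)

theorem measurable_shiftedKernel (D : ℝ) : Measurable (shiftedKernel D) :=
  Measurable.ite (measurableSet_singleton 0) measurable_const (by fun_prop)

theorem shiftedKernel_zero (D : ℝ) : shiftedKernel D 0 = ⊤ := if_pos rfl

theorem shiftedKernel_of_pos (D : ℝ) {r : ℝ} (h : 0 < r) :
    shiftedKernel D r = ENNReal.ofReal (Real.log D - Real.log r) := if_neg h.ne'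

theorem shiftedKernel_anti (D : ℝ) {r t : ℝ} (hr : 0 ≤ r) (h : r ≤ t) :
    shiftedKernel D t ≤ shiftedKernel D r := by
  rcases hr.eq_or_lt with rfl | hr
  · rw [shiftedKernel_zero]
    exact le_top
  · rw [shiftedKernel_of_pos D hr, shiftedKernel_of_pos D (hr.trans_le h)]
    exact ENNReal.ofReal_le_ofReal (sub_le_sub_left (Real.log_le_log hr h) _)

/-- Comparison of the kernel at two scales. -/
theorem shiftedKernel_mul_le (D : ℝ) {r t : ℝ} (hr : 0 < r) (ht : 0 ≤ t) :
    shiftedKernel D (r * t) ≤ ENNReal.ofReal (Real.log D - Real.log r) + shiftedKernel 1 t := by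
  rcases ht.eq_or_lt with rfl | ht
  · simp [shiftedKernel_zero]
  · rw [shiftedKernel_of_pos D (by positivity), shiftedKernel_of_pos 1 ht,
      Real.log_mul hr.ne' ht.ne', Real.log_one]
    refine le_trans (ENNReal.ofReal_le_ofReal (le_of_eq ?_)) ENNReal.ofReal_add_le
    ring

theorem lintegral_shiftedKernel_abs_lt_top : ∫⁻ v : ℝ, shiftedKernel 1 |v| < ⊤ := by
  have h1 : IntegrableOn Real.log (Set.Ioc (-1) 1) :=
    (intervalIntegrable_iff_integrableOn_Ioc_of_le (by norm_num)).1
      intervalIntegral.intervalIntegrable_log'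
  have h2 : ∫⁻ v : ℝ, shiftedKernel 1 |v| ≤
      ∫⁻ v in Set.Ioc (-1 : ℝ) 1, ENNReal.ofReal (-Real.log v) := by
    rw [← lintegral_indicator measurableSet_Ioc]
    -- Two null points are discarded: the kernel is `⊤` at `0`, and `-1` lies outside `Ioc`.
    -- Elsewhere outside the interval `|v| ≥ 1`, and the truncated kernel vanishes.
    have h0 : ∀ᵐ v : ℝ, v ≠ 0 := by simp [ae_iff]
    have h3 : ∀ᵐ v : ℝ, v ≠ -1 := by simp [ae_iff]
    refine lintegral_mono_ae ?_
    filter_upwards [h0, h3] with v hv hv1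
    rw [shiftedKernel_of_pos 1 (abs_pos.2 hv), Real.log_abs, Real.log_one, zero_sub]
    by_cases hm : v ∈ Set.Ioc (-1 : ℝ) 1
    · rw [Set.indicator_of_mem hm]
    · rw [Set.indicator_of_notMem hm, nonpos_iff_eq_zero, ENNReal.ofReal_eq_zero, neg_nonpos,
        ← Real.log_abs]
      refine Real.log_nonneg (le_of_not_gt fun h => hm ?_)
      rw [abs_lt] at h
      exact ⟨h.1, h.2.le⟩
  exact h2.trans_lt h1.neg.lintegral_lt_top

theorem shiftedKernel_norm_ae {μ : Measure ℂ} {D : ℝ}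
    (hne : ∀ᵐ p ∂(μ.prod μ), p.1 ≠ p.2) :
    ∀ᵐ p ∂(μ.prod μ), shiftedKernel D ‖p.1 - p.2‖ =
      ENNReal.ofReal (realKernel p + Real.log D) := by
  filter_upwards [hne] with p hp
  rw [shiftedKernel_of_pos D (norm_pos_iff.2 (sub_ne_zero.2 hp)), realKernel]
  ring_nf

theorem realKernel_add_log_nonneg_ae {μ : Measure ℂ} {D : ℝ}
    (hne : ∀ᵐ p ∂(μ.prod μ), p.1 ≠ p.2) (hD : ∀ᵐ p ∂(μ.prod μ), ‖p.1 - p.2‖ ≤ D) :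
    ∀ᵐ p ∂(μ.prod μ), 0 ≤ realKernel p + Real.log D := by
  filter_upwards [hne, hD] with p hp h
  rw [realKernel, neg_add_eq_sub, sub_nonneg]
  exact Real.log_le_log (norm_pos_iff.2 (sub_ne_zero.2 hp)) h

theorem lintegral_shiftedKernel_eq {μ : Measure ℂ} [IsProbabilityMeasure μ] {D : ℝ}
    (hd : (μ.prod μ) {p : ℂ × ℂ | p.1 = p.2} = 0) (hi : Integrable realKernel (μ.prod μ))
    (hD : ∀ᵐ p ∂(μ.prod μ), ‖p.1 - p.2‖ ≤ D) :
    0 ≤ ∫ p, realKernel p ∂(μ.prod μ) + Real.log D ∧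
    ∫⁻ p, shiftedKernel D ‖p.1 - p.2‖ ∂(μ.prod μ) =
      ENNReal.ofReal (∫ p, realKernel p ∂(μ.prod μ) + Real.log D) := by
  have hne : ∀ᵐ p ∂(μ.prod μ), p.1 ≠ p.2 := by
    rw [ae_iff]
    simpa using hd
  have hnn := realKernel_add_log_nonneg_ae hne hD
  have hsum : ∫ p, (realKernel p + Real.log D) ∂(μ.prod μ) =
      ∫ p, realKernel p ∂(μ.prod μ) + Real.log D := by
    rw [integral_add hi (integrable_const _)]
    simp
  rw [lintegral_congr_ae (shiftedKernel_norm_ae hne), ← hsum]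
  exact ⟨integral_nonneg_of_ae hnn,
    (ofReal_integral_eq_lintegral_ofReal (hi.add (integrable_const _)) hnn).symm⟩

/-- Finiteness of the shifted energy implies finiteness of the energy. -/
theorem integrable_realKernel_of_shifted {μ : Measure ℂ} [IsProbabilityMeasure μ] {D : ℝ}
    (hD : ∀ᵐ p ∂(μ.prod μ), ‖p.1 - p.2‖ ≤ D)
    (hf : ∫⁻ p, shiftedKernel D ‖p.1 - p.2‖ ∂(μ.prod μ) < ⊤) :
    (μ.prod μ) {p : ℂ × ℂ | p.1 = p.2} = 0 ∧ Integrable realKernel (μ.prod μ) := by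
  have hm : Measurable fun p : ℂ × ℂ => shiftedKernel D ‖p.1 - p.2‖ :=
    (measurable_shiftedKernel D).comp (by fun_prop)
  have hne : ∀ᵐ p ∂(μ.prod μ), p.1 ≠ p.2 := by
    filter_upwards [ae_lt_top hm hf.ne] with p hp h
    simp [h, shiftedKernel_zero] at hp
  have hnn := realKernel_add_log_nonneg_ae hne hD
  refine ⟨by simpa [ae_iff] using hne, ?_⟩
  have h1 : Integrable (fun p => realKernel p + Real.log D) (μ.prod μ) := by
    refine ⟨(measurable_realKernel.add_const _).aestronglyMeasurable, ?_⟩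
    rw [hasFiniteIntegral_iff_ofReal hnn, ← lintegral_congr_ae (shiftedKernel_norm_ae hne)]
    exact hf
  exact (h1.sub (integrable_const (Real.log D))).congr (.of_forall fun p => add_sub_cancel_right _ _)

/-! ### The embedding of the plane -/

namespace ExtendedPlane

theorem dist_ofComplex (z w : ℂ) : dist (ofComplex z) (ofComplex w) =
    ‖z - w‖ / (Real.sqrt (1 + ‖z‖ ^ 2) * Real.sqrt (1 + ‖w‖ ^ 2)) := rfl

theorem one_le_sqrt_one_add_sq (z : ℂ) : 1 ≤ Real.sqrt (1 + ‖z‖ ^ 2) :=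
  Real.one_le_sqrt.2 (by nlinarith [sq_nonneg ‖z‖])

theorem continuous_ofComplex : Continuous ofComplex := by
  refine LipschitzWith.continuous (K := 1) (LipschitzWith.mk_one fun z w => ?_)
  rw [dist_ofComplex, dist_eq_norm]
  exact div_le_self (norm_nonneg _)
    (one_le_mul_of_one_le_of_one_le (one_le_sqrt_one_add_sq z) (one_le_sqrt_one_add_sq w))

theorem ofComplex_injective : Function.Injective ofComplex :=
  OnePoint.coe_injective

/-- Points that are chordally close to a finite point are finite and close in the plane. -/
theorem exists_eq_ofComplex_of_dist_lt {X : ExtendedPlane} {w : ℂ} {δ : ℝ}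
    (h : dist X (ofComplex w) < δ) (hδ : 2 * δ * Real.sqrt (1 + ‖w‖ ^ 2) ≤ 1) :
    ∃ z, X = ofComplex z ∧ ‖z - w‖ ≤ 2 * δ * (1 + ‖w‖ ^ 2) := by
  have hA := one_le_sqrt_one_add_sq w
  have hA2 : Real.sqrt (1 + ‖w‖ ^ 2) ^ 2 = 1 + ‖w‖ ^ 2 := Real.sq_sqrt (by positivity)
  set A := Real.sqrt (1 + ‖w‖ ^ 2) with hAdef
  have hδ0 : 0 < δ := dist_nonneg.trans_lt h
  match X with
  | OnePoint.some z =>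
    refine ⟨z, rfl, ?_⟩
    have h1 : ‖z - w‖ / (Real.sqrt (1 + ‖z‖ ^ 2) * A) < δ := h
    have hB := one_le_sqrt_one_add_sq z
    -- The square root is the norm of `lift`, hence 1-Lipschitz in the point. The bound on `δ` then
    -- lets half of `‖z - w‖` be absorbed on the left.
    have hBA : Real.sqrt (1 + ‖z‖ ^ 2) ≤ A + ‖z - w‖ := by
      rw [hAdef, ← norm_lift, ← norm_lift, ← norm_lift_sub]
      exact norm_le_norm_add_norm_sub' _ _
    rw [div_lt_iff₀ (by positivity)] at h1
    rw [← hA2]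
    have h2 : δ * (Real.sqrt (1 + ‖z‖ ^ 2) * A) ≤ δ * ((A + ‖z - w‖) * A) := by gcongr
    have h3 : 2 * δ * A * ‖z - w‖ ≤ 1 * ‖z - w‖ := by gcongr
    nlinarith
  | OnePoint.infty =>
    exfalso
    have h1 : 1 / A < δ := h
    rw [div_lt_iff₀ (by positivity)] at h1
    nlinarith

theorem isOpenMap_ofComplex : IsOpenMap ofComplex := by
  refine IsOpenMap.of_nhds_le fun w => ?_
  intro S hS
  obtain ⟨ε, hε, hS⟩ := Metric.mem_nhds_iff.1 (Filter.mem_map.1 hS)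
  have hA := one_le_sqrt_one_add_sq w
  set A := Real.sqrt (1 + ‖w‖ ^ 2) with hAdef
  have hW : 0 < 1 + ‖w‖ ^ 2 := by positivity
  refine Metric.mem_nhds_iff.2 ⟨min (1 / (2 * A)) (ε / (4 * (1 + ‖w‖ ^ 2))), by positivity, ?_⟩
  intro X hX
  have hX : dist X (ofComplex w) < _ := hX
  obtain ⟨z, rfl, hz⟩ := exists_eq_ofComplex_of_dist_lt hX (by
    calc 2 * min (1 / (2 * A)) (ε / (4 * (1 + ‖w‖ ^ 2))) * A
        ≤ 2 * (1 / (2 * A)) * A := by gcongr; exact min_le_left _ _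
      _ = 1 := by field_simp)
  refine hS ?_
  rw [Metric.mem_ball, dist_eq_norm]
  calc ‖z - w‖ ≤ _ := hz
    _ ≤ 2 * (ε / (4 * (1 + ‖w‖ ^ 2))) * (1 + ‖w‖ ^ 2) := by gcongr; exact min_le_right _ _
    _ = ε / 2 := by field_simp; norm_num
    _ < ε := by linarith

/-- If a circle around a point `z` of `Γ` misses `Γ` then the component of `z` lies inside it. -/
theorem norm_sub_lt_of_component_eq {Γ : Set ExtendedPlane} {z w : ℂ} {t : ℝ} (ht : 0 ≤ t)
    (hz : ofComplex z ∈ Γ) (hw : ofComplex w ∈ Γ)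
    (hmiss : ∀ y, ofComplex y ∈ Γ → ‖y - z‖ ≠ t)
    (heq : ConnectedComponents.mk (⟨ofComplex w, hw⟩ : Γ) = ConnectedComponents.mk ⟨ofComplex z, hz⟩) :
    ‖w - z‖ < t := by
  have ht0 : 0 < t := lt_of_le_of_ne ht fun h => hmiss z hz (by simpa using h)
  -- The open and the closed disc have the same trace on `Γ`, since the circle misses it. That trace
  -- is clopen and so contains the component of `z`.
  let U : Set Γ := (↑) ⁻¹' (ofComplex '' Metric.ball z t)
  have hU : U = (↑) ⁻¹' (ofComplex '' Metric.closedBall z t) := by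
    ext ⟨X, hX⟩
    constructor
    · rintro ⟨y, hy, rfl⟩
      exact ⟨y, Metric.ball_subset_closedBall hy, rfl⟩
    · rintro ⟨y, hy, rfl⟩
      refine ⟨y, ?_, rfl⟩
      rw [Metric.mem_closedBall, dist_eq_norm] at hy
      rw [Metric.mem_ball, dist_eq_norm]
      exact lt_of_le_of_ne hy (hmiss y hX)
  have hcl : IsClopen U := by
    constructor
    · rw [hU]
      exact ((isCompact_closedBall z t).image continuous_ofComplex).isClosed.preimage
        continuous_subtype_val
    · exact (isOpenMap_ofComplex _ Metric.isOpen_ball).preimage continuous_subtype_val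
  have hmem : (⟨ofComplex w, hw⟩ : Γ) ∈ U := by
    refine hcl.connectedComponent_subset (x := ⟨ofComplex z, hz⟩)
      ⟨z, Metric.mem_ball_self ht0, rfl⟩ ?_
    rw [← ConnectedComponents.coe_eq_coe.1 heq]
    exact mem_connectedComponent
  obtain ⟨y, hy, hyw⟩ := hmem
  rw [ofComplex_injective hyw, Metric.mem_ball, dist_eq_norm] at hy
  exact hy

end ExtendedPlane

open ExtendedPlane

/-- Every circle around `z` of radius at most `ρ` meets `Γ`. -/
def MeetsCircles (Γ : Set ExtendedPlane) (ρ : ℝ) (z : ℂ) : Prop :=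
  ∀ t ∈ Set.Icc 0 ρ, ∃ y, ofComplex y ∈ Γ ∧ ‖y - z‖ = t

/-- The part of the plane near the points of `Γ` around which some small circle misses `Γ` carries
little mass, if `Γ` has few components. -/
theorem measure_near_not_meetsCircles_le {Γ : Set ExtendedPlane} [Finite (ConnectedComponents Γ)]
    {ρ : ℝ} {μ : Measure ℂ} [SFinite μ] {η : ℝ≥0∞}
    (hη : (μ.prod μ) {p : ℂ × ℂ | ‖p.1 - p.2‖ ≤ 3 * ρ} ≤ η * η) :
    μ {x | ∃ z, ofComplex z ∈ Γ ∧ ‖x - z‖ ≤ ρ ∧ ¬ MeetsCircles Γ ρ z} ≤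
      Nat.card (ConnectedComponents Γ) * η := by
  have := Fintype.ofFinite (ConnectedComponents Γ)
  let B : ConnectedComponents Γ → Set ℂ := fun i =>
    {x | ∃ z, ∃ h : ofComplex z ∈ Γ, ConnectedComponents.mk (⟨ofComplex z, h⟩ : Γ) = i ∧
      ‖x - z‖ ≤ ρ ∧ ¬ MeetsCircles Γ ρ z}
  have hB : ∀ i, μ (B i) ≤ η := by
    intro i
    -- Three distances of at most `ρ` each: from `x` to `z`, from `z` to `w` inside the common
    -- component, and from `w` to `y`.
    have h1 : B i ×ˢ B i ⊆ {p : ℂ × ℂ | ‖p.1 - p.2‖ ≤ 3 * ρ} := by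
      rintro ⟨x, y⟩ ⟨⟨z, hz, hzi, hxz, hzb⟩, ⟨w, hw, hwi, hyw, -⟩⟩
      obtain ⟨t, ht, hmiss⟩ : ∃ t ∈ Set.Icc 0 ρ, ∀ y, ofComplex y ∈ Γ → ‖y - z‖ ≠ t := by
        simpa only [MeetsCircles, not_forall, not_exists, not_and, exists_prop] using hzb
      have h2 := norm_sub_lt_of_component_eq ht.1 hz hw hmiss (hwi.trans hzi.symm)
      have h3 : ‖x - y‖ ≤ ‖x - z‖ + ‖y - w‖ + ‖w - z‖ := by
        calc ‖x - y‖ = ‖(x - z) - (y - w) - (w - z)‖ := by congr 1; ring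
          _ ≤ _ := (norm_sub_le _ _).trans (add_le_add_left (norm_sub_le _ _) _)
      simp only [Set.mem_ofPred_eq]
      linarith [ht.2]
    by_contra! hlt
    have h2 := (measure_mono h1).trans hη
    rw [Measure.prod_prod] at h2
    exact absurd (ENNReal.mul_lt_mul hlt hlt) (not_lt.2 h2)
  calc μ {x | ∃ z, ofComplex z ∈ Γ ∧ ‖x - z‖ ≤ ρ ∧ ¬ MeetsCircles Γ ρ z}
      ≤ μ (⋃ i, B i) := by
        refine measure_mono ?_
        rintro x ⟨z, hz, hx⟩
        exact Set.mem_iUnion.2 ⟨_, z, hz, rfl, hx⟩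
    _ ≤ ∑ i, μ (B i) := measure_iUnion_fintype_le _ _
    _ ≤ ∑ _i : ConnectedComponents Γ, η := Finset.sum_le_sum fun i _ => hB i
    _ = _ := by simp [Nat.card_eq_fintype_card]

/-! ### Measurable selections on compact sets -/

/-- The smallest value of `h` on the fibres in `C` of a continuous map depends measurably on the
base point. -/
theorem exists_measurable_fibre_value {X Y : Type*} [TopologicalSpace X] [TopologicalSpace Y]
    [T2Space Y] [MeasurableSpace Y] [BorelSpace Y] {C : Set X} (hC : IsCompact C) {f : X → Y}
    (hf : Continuous f) {h : X → ℝ} (hh : Continuous h) :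
    ∃ m : Y → ℝ, Measurable m ∧ ∀ y ∈ f '' C, ∃ x ∈ C, f x = y ∧ h x = m y := by
  have hmin : ∀ y ∈ f '' C, ∃ x ∈ C, f x = y ∧ h x = sInf (h '' (C ∩ f ⁻¹' {y})) := by
    rintro y ⟨x, hx, rfl⟩
    have hcomp : IsCompact (C ∩ f ⁻¹' {f x}) :=
      hC.inter_right (isClosed_singleton.preimage hf)
    obtain ⟨x', hx', he⟩ := (hcomp.image hh).sInf_mem (Set.Nonempty.image _ ⟨x, hx, rfl⟩)
    exact ⟨x', hx'.1, hx'.2, he⟩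
  refine ⟨fun y => sInf (h '' (C ∩ f ⁻¹' {y})), measurable_of_Iic fun a => ?_, hmin⟩
  -- A sublevel set is the image of a compact set, except that empty fibres take the default value
  -- `sInf ∅ = 0`; the second piece accounts for them.
  have hset : (fun y => sInf (h '' (C ∩ f ⁻¹' {y}))) ⁻¹' Set.Iic a =
      f '' (C ∩ h ⁻¹' Set.Iic a) ∪ ((f '' C)ᶜ ∩ {_y | (0 : ℝ) ≤ a}) := by
    ext y
    by_cases hy : y ∈ f '' C
    · simp only [Set.mem_preimage, Set.mem_Iic, Set.mem_union, Set.mem_inter_iff, Set.mem_compl_iff,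
        hy, not_true_eq_false, false_and, or_false]
      constructor
      · intro hle
        obtain ⟨x, hx, hxy, he⟩ := hmin y hy
        exact ⟨x, ⟨hx, he.trans_le hle⟩, hxy⟩
      · rintro ⟨x, ⟨hx, hxa⟩, rfl⟩
        have hcomp : IsCompact (C ∩ f ⁻¹' {f x}) :=
          hC.inter_right (isClosed_singleton.preimage hf)
        exact (csInf_le (hcomp.image hh).bddBelow ⟨x, ⟨hx, rfl⟩, rfl⟩).trans hxa
    · have hemp : C ∩ f ⁻¹' {y} = ∅ := by
        ext x
        simp only [Set.mem_inter_iff, Set.mem_preimage, Set.mem_singleton_iff,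
          Set.mem_empty_iff_false, iff_false, not_and]
        exact fun hx hxy => hy ⟨x, hx, hxy⟩
      have hn : y ∉ f '' (C ∩ h ⁻¹' Set.Iic a) := fun h' => hy (Set.image_mono Set.inter_subset_left h')
      simp only [Set.mem_preimage, hemp, Set.image_empty, Real.sInf_empty, Set.mem_Iic,
        Set.mem_union, hn, Set.mem_inter_iff, Set.mem_compl_iff, hy, not_false_eq_true, true_and,
        false_or, Set.mem_ofPred_eq]
  rw [hset]
  refine MeasurableSet.union ?_ (MeasurableSet.inter ?_ (MeasurableSet.const _))
  · exact ((hC.inter_right (isClosed_Iic.preimage hh)).image hf).isClosed.measurableSet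
  · exact (hC.image hf).isClosed.measurableSet.compl

/-- The lexicographic minimum of each fibre is selected: least real part, then least imaginary part
among the points with that real part. -/
theorem exists_measurable_section {C : Set ℂ} (hC : IsCompact C) {f : ℂ → ℝ}
    (hf : Continuous f) : ∃ g : ℝ → ℂ, Measurable g ∧ ∀ t ∈ f '' C, g t ∈ C ∧ f (g t) = t := by
  obtain ⟨m, hm, hm'⟩ := exists_measurable_fibre_value hC hf Complex.continuous_re
  obtain ⟨n, hn, hn'⟩ := exists_measurable_fibre_value hC
    (hf.prodMk Complex.continuous_re) Complex.continuous_im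
  refine ⟨fun t => (m t : ℂ) + (n (t, m t) : ℂ) * Complex.I, by fun_prop, fun t ht => ?_⟩
  obtain ⟨x, hx, hxt, hxm⟩ := hm' t ht
  obtain ⟨y, hy, hyt, hyn⟩ := hn' (t, m t) ⟨x, hx, Prod.ext hxt hxm⟩
  obtain ⟨h1, h2⟩ := Prod.ext_iff.1 hyt
  have : (m t : ℂ) + (n (t, m t) : ℂ) * Complex.I = y := by
    rw [← hyn, ← show y.re = m t from h2, Complex.re_add_im]
  simp only [this]
  exact ⟨hy, h1⟩

/-- A measurable curve in `Γ` whose distance from `z` grows linearly. -/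
theorem MeetsCircles.exists_curve {Γ : Set ExtendedPlane} (hΓ : IsClosed Γ) {ρ : ℝ}
    (hρ : 0 ≤ ρ) {z : ℂ} (h : MeetsCircles Γ ρ z) :
    ∃ g : ℝ → ℂ, Measurable g ∧ ∀ t ∈ Set.Icc (0 : ℝ) 1, ofComplex (g t) ∈ Γ ∧ ‖g t - z‖ = ρ * t := by
  have hC : IsCompact (Metric.closedBall z ρ ∩ ofComplex ⁻¹' Γ) :=
    (isCompact_closedBall z ρ).inter_right (hΓ.preimage continuous_ofComplex)
  obtain ⟨g, hg, hg'⟩ := exists_measurable_section hC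
    (f := fun y => ‖y - z‖) (by fun_prop)
  refine ⟨fun t => g (ρ * t), by fun_prop, fun t ht => ?_⟩
  have ht' : ρ * t ∈ Set.Icc 0 ρ := ⟨mul_nonneg hρ ht.1, mul_le_of_le_one_right hρ ht.2⟩
  obtain ⟨y, hy, hyt⟩ := h _ ht'
  have := hg' (ρ * t) ⟨y, ⟨by rw [Metric.mem_closedBall, dist_eq_norm, hyt]; exact ht'.2, hy⟩, hyt⟩
  exact ⟨this.1.2, this.2⟩

/-! ### Restriction of measures to large sets -/

theorem cond_prod_cond {μ : Measure ℂ} [IsFiniteMeasure μ] (G : Set ℂ) :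
    (μ[|G]).prod (μ[|G]) = ((μ G)⁻¹ * (μ G)⁻¹) • (μ.prod μ).restrict (G ×ˢ G) := by
  rw [ProbabilityTheory.cond, Measure.prod_smul_left, Measure.prod_smul_right,
    Measure.prod_restrict, smul_smul]

theorem integral_cond_prod_cond {μ : Measure ℂ} [IsFiniteMeasure μ] (G : Set ℂ) (f : ℂ × ℂ → ℝ) :
    ∫ p, f p ∂((μ[|G]).prod (μ[|G])) =
      (μ.real G)⁻¹ * (μ.real G)⁻¹ * ∫ p in G ×ˢ G, f p ∂(μ.prod μ) := by
  rw [cond_prod_cond, integral_smul_measure, ENNReal.toReal_mul, ENNReal.toReal_inv, smul_eq_mul]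
  rfl

theorem integral_cond_eq {μ : Measure ℂ} [IsFiniteMeasure μ] (G : Set ℂ) (f : ℂ → ℝ) :
    ∫ x, f x ∂(μ[|G]) = (μ.real G)⁻¹ * ∫ x in G, f x ∂μ := by
  rw [ProbabilityTheory.cond, integral_smul_measure, ENNReal.toReal_inv, smul_eq_mul]
  rfl

/-- Conditioning on a set of almost full measure changes a quadratic functional only a little. -/
theorem exists_energy_cond_lt {μ : Measure ℂ} [IsProbabilityMeasure μ] {h : ℂ × ℂ → ℝ}
    (hh : Integrable h (μ.prod μ)) {φ : ℂ → ℝ} (hφ : Integrable φ μ) {c : ℝ}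
    (hc : ∫ p, h p ∂(μ.prod μ) + 2 * ∫ x, φ x ∂μ < c) :
    ∃ ε : ℝ≥0∞, 0 < ε ∧ ∀ G, MeasurableSet G → μ Gᶜ < ε → 1 / 2 ≤ μ G ∧
      ∫ p, h p ∂((μ[|G]).prod (μ[|G])) + 2 * ∫ x, φ x ∂(μ[|G]) < c := by
  -- The filter of measurable sets whose complement has mass tending to zero. Every quantity below
  -- is continuous along it, and the threshold `ε` is read off at the end.
  let l : Filter (Set ℂ) := comap (fun G => μ Gᶜ) (𝓝 0) ⊓ 𝓟 {G | MeasurableSet G}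
  have hl : Tendsto (fun G : Set ℂ => μ Gᶜ) l (𝓝 0) := tendsto_comap.mono_left inf_le_left
  have hm : ∀ᶠ G in l, MeasurableSet G := eventually_inf_principal.2 (.of_forall fun _ h => h)
  have hl2 : Tendsto ((μ.prod μ) ∘ fun G : Set ℂ => (G ×ˢ G)ᶜ) l (𝓝 0) := by
    have h2 : Tendsto (fun G : Set ℂ => μ Gᶜ + μ Gᶜ) l (𝓝 0) := by simpa using hl.add hl
    refine tendsto_of_tendsto_of_tendsto_of_le_of_le tendsto_const_nhds h2 (fun _ => zero_le)
      fun G => ?_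
    simp only [Function.comp]
    rw [Set.compl_prod_eq_union]
    refine (measure_union_le _ _).trans ?_
    rw [Measure.prod_prod, Measure.prod_prod]
    simp
  have t1 : Tendsto (fun G => ∫ p in G ×ˢ G, h p ∂(μ.prod μ)) l (𝓝 (∫ p, h p ∂(μ.prod μ))) := by
    have := tendsto_const_nhds (x := ∫ p, h p ∂(μ.prod μ)) |>.sub
      (hh.tendsto_setIntegral_nhds_zero hl2)
    rw [sub_zero] at this
    refine this.congr' (hm.mono fun G hG => ?_)
    rw [sub_eq_iff_eq_add, integral_add_compl (hG.prod hG) hh]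
  have t2 : Tendsto (fun G => ∫ x in G, φ x ∂μ) l (𝓝 (∫ x, φ x ∂μ)) := by
    have := tendsto_const_nhds (x := ∫ x, φ x ∂μ) |>.sub
      (hφ.tendsto_setIntegral_nhds_zero (s := fun G => Gᶜ) hl)
    rw [sub_zero] at this
    refine this.congr' (hm.mono fun G hG => ?_)
    rw [sub_eq_iff_eq_add, integral_add_compl hG hφ]
  have t3 : Tendsto (fun G => μ G) l (𝓝 1) := by
    have := ENNReal.Tendsto.sub (tendsto_const_nhds (x := (1 : ℝ≥0∞))) hl (by simp)
    rw [tsub_zero] at this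
    refine this.congr' (hm.mono fun G hG => ?_)
    rw [← prob_compl_eq_one_sub hG.compl, compl_compl]
  have t4 : Tendsto (fun G => (μ.real G)⁻¹) l (𝓝 1) := by
    have := ((ENNReal.tendsto_toReal ENNReal.one_ne_top).comp t3).inv₀ (by simp)
    rwa [ENNReal.toReal_one, inv_one] at this
  have t5 : Tendsto (fun G => ∫ p, h p ∂((μ[|G]).prod (μ[|G])) + 2 * ∫ x, φ x ∂(μ[|G])) l
      (𝓝 (∫ p, h p ∂(μ.prod μ) + 2 * ∫ x, φ x ∂μ)) := by
    simp only [integral_cond_prod_cond, integral_cond_eq]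
    simpa using ((t4.mul t4).mul t1).add ((t4.mul t2).const_mul 2)
  have hev : ∀ᶠ G in l, 1 / 2 ≤ μ G ∧
      ∫ p, h p ∂((μ[|G]).prod (μ[|G])) + 2 * ∫ x, φ x ∂(μ[|G]) < c := by
    have half : (1 / 2 : ℝ≥0∞) < 1 := by simp
    exact ((t3.eventually (lt_mem_nhds half)).mono fun _ h => h.le).and
      (t5.eventually (gt_mem_nhds hc))
  rw [eventually_inf_principal, eventually_comap] at hev
  obtain ⟨ε, hε, hε'⟩ := (ENNReal.nhds_zero_basis).mem_iff.1 hev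
  exact ⟨ε, hε, fun G hG hGε => hε' hGε G rfl hG⟩

/-- The mass of a tube around the diagonal tends to zero with its width. -/
theorem tendsto_measure_near_diagonal {μ : Measure ℂ} [IsFiniteMeasure μ]
    (hd : (μ.prod μ) {p : ℂ × ℂ | p.1 = p.2} = 0) (a : ℝ) :
    Tendsto (fun ρ : ℝ => (μ.prod μ) {p : ℂ × ℂ | ‖p.1 - p.2‖ ≤ a * ρ}) (𝓝[>] 0) (𝓝 0) := by
  have hms : ∀ r : ℝ, MeasurableSet {p : ℂ × ℂ | ‖p.1 - p.2‖ ≤ r} := fun r =>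
    measurableSet_le (by fun_prop) measurable_const
  rcases le_or_gt a 0 with ha | ha
  · refine tendsto_const_nhds.congr' ?_
    filter_upwards [self_mem_nhdsWithin] with ρ hρ
    refine (measure_mono_null (fun p hp => ?_) hd).symm
    have h1 : ‖p.1 - p.2‖ ≤ a * ρ := hp
    exact sub_eq_zero.1 (norm_le_zero_iff.1
      (h1.trans (mul_nonpos_of_nonpos_of_nonneg ha (le_of_lt hρ))))
  have key := tendsto_measure_biInter_gt (μ := μ.prod μ)
    (s := fun ρ : ℝ => {p : ℂ × ℂ | ‖p.1 - p.2‖ ≤ a * ρ}) (a := 0)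
    (fun r _ => (hms _).nullMeasurableSet)
    (fun i j _ hij p hp => le_trans (show ‖p.1 - p.2‖ ≤ a * i from hp) (by gcongr))
    ⟨1, one_pos, measure_ne_top _ _⟩
  have hz : (μ.prod μ) (⋂ r > 0, {p : ℂ × ℂ | ‖p.1 - p.2‖ ≤ a * r}) = 0 := by
    refine measure_mono_null (fun p hp => ?_) hd
    have h1 : ∀ r > 0, ‖p.1 - p.2‖ ≤ a * r := by simpa using hp
    refine sub_eq_zero.1 (norm_le_zero_iff.1 (le_of_forall_pos_le_add fun ε hε => ?_))
    have := h1 (ε / a) (by positivity)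
    rwa [mul_div_cancel₀ _ ha.ne', ← zero_add ε] at this
  rwa [hz] at key

/-! ### Spreading a measure along curves -/

/-- The energy of a point charge against a unit charge spread along a curve that leaves a centre
`w` at constant speed. -/
theorem lintegral_shiftedKernel_curve_le {g : ℝ → ℂ} {w : ℂ} {ρ : ℝ} (hρ : 0 < ρ)
    (hg : ∀ t ∈ Set.Icc (0 : ℝ) 1, ‖g t - w‖ = ρ * t) (D : ℝ) (z : ℂ) :
    ∫⁻ u in Set.Icc (0 : ℝ) 1, shiftedKernel D ‖z - g u‖ ≤
      ENNReal.ofReal (Real.log D - Real.log ρ) + ∫⁻ v : ℝ, shiftedKernel 1 |v| := by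
  have hm : Measurable fun v : ℝ => shiftedKernel 1 |v| :=
    (measurable_shiftedKernel 1).comp (by fun_prop)
  -- By the reverse triangle inequality `‖z - g u‖ ≥ ρ * |a - u|`. The bound does not depend on `a`,
  -- by translation invariance of Lebesgue measure.
  set a := ‖z - w‖ / ρ with ha
  calc ∫⁻ u in Set.Icc (0 : ℝ) 1, shiftedKernel D ‖z - g u‖
      ≤ ∫⁻ u in Set.Icc (0 : ℝ) 1,
          (ENNReal.ofReal (Real.log D - Real.log ρ) + shiftedKernel 1 |a - u|) := by
        refine setLIntegral_mono' measurableSet_Icc fun u hu => ?_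
        refine le_trans (shiftedKernel_anti D (by positivity) ?_)
          (shiftedKernel_mul_le D hρ (abs_nonneg _))
        calc ρ * |a - u| = |‖z - w‖ - ‖g u - w‖| := by
              rw [hg u hu, ← abs_of_pos hρ, ← abs_mul, abs_of_pos hρ, ha, mul_sub,
                mul_div_cancel₀ _ hρ.ne']
          _ ≤ ‖(z - w) - (g u - w)‖ := abs_norm_sub_norm_le _ _
          _ = ‖z - g u‖ := by rw [sub_sub_sub_cancel_right]
    _ = ENNReal.ofReal (Real.log D - Real.log ρ) +
          ∫⁻ u in Set.Icc (0 : ℝ) 1, shiftedKernel 1 |a - u| := by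
        rw [lintegral_add_left measurable_const, setLIntegral_const, Real.volume_Icc]
        simp
    _ ≤ _ := by
        refine add_le_add le_rfl ((setLIntegral_le_lintegral _ _).trans (le_of_eq ?_))
        exact lintegral_sub_left_eq_self (fun v => shiftedKernel 1 |v|) a

/-- The near field constant of the spreading estimate. -/
def nearConstant (M : ℝ) : ℝ≥0∞ :=
  ENNReal.ofReal (Real.log M) + ∫⁻ v : ℝ, shiftedKernel 1 |v|

theorem nearConstant_lt_top (M : ℝ) : nearConstant M < ⊤ :=
  ENNReal.add_lt_top.2 ⟨ENNReal.ofReal_lt_top, lintegral_shiftedKernel_abs_lt_top⟩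

/-- Pairs within `M * ρ` use the curve estimate, with `-log ρ ≤ log M - log ‖x - y‖`. For other
pairs the total displacement is at most `2 * ρ + ρ + ρ = 4 * ρ`, a fraction `4 / M` of `‖x - y‖`. -/
theorem lintegral_shiftedKernel_spread_le {g : ℝ → ℂ} {w x y z : ℂ} {ρ M : ℝ} (hρ : 0 < ρ)
    (hM : 4 < M) (hg : ∀ t ∈ Set.Icc (0 : ℝ) 1, ‖g t - w‖ = ρ * t) (hy : ‖y - w‖ ≤ ρ)
    (hz : ‖z - x‖ ≤ 2 * ρ) (D : ℝ) :
    ∫⁻ u in Set.Icc (0 : ℝ) 1, shiftedKernel D ‖z - g u‖ ≤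
      shiftedKernel D ‖x - y‖ + ENNReal.ofReal (-Real.log (1 - 4 / M)) +
        {p : ℂ × ℂ | ‖p.1 - p.2‖ ≤ M * ρ}.indicator (fun _ => nearConstant M) (x, y) := by
  rcases (norm_nonneg (x - y)).eq_or_lt with h0 | h0
  · rw [← h0, shiftedKernel_zero]
    simp
  rw [shiftedKernel_of_pos D h0]
  by_cases hn : ‖x - y‖ ≤ M * ρ
  · rw [Set.indicator_of_mem (by exact hn), nearConstant]
    refine (lintegral_shiftedKernel_curve_le hρ hg D z).trans ?_
    rw [← add_assoc]
    gcongr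
    have h1 : Real.log ‖x - y‖ ≤ Real.log M + Real.log ρ := by
      rw [← Real.log_mul (by positivity) hρ.ne']
      exact Real.log_le_log h0 hn
    calc ENNReal.ofReal (Real.log D - Real.log ρ)
        ≤ ENNReal.ofReal ((Real.log D - Real.log ‖x - y‖) + Real.log M) :=
          ENNReal.ofReal_le_ofReal (by linarith)
      _ ≤ ENNReal.ofReal (Real.log D - Real.log ‖x - y‖) + ENNReal.ofReal (Real.log M) :=
          ENNReal.ofReal_add_le
      _ ≤ _ := by gcongr; exact le_self_add
  · rw [Set.indicator_of_notMem (by exact hn), add_zero]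
    rw [not_le] at hn
    have hM0 : 0 < M := by linarith
    have h4 : 0 < 1 - 4 / M := by
      rw [sub_pos, div_lt_one hM0]
      exact hM
    have h5 : ∀ u ∈ Set.Icc (0 : ℝ) 1, shiftedKernel D ‖z - g u‖ ≤
        ENNReal.ofReal (Real.log D - Real.log ‖x - y‖) +
          ENNReal.ofReal (-Real.log (1 - 4 / M)) := by
      intro u hu
      have h6 : ‖x - y‖ * (1 - 4 / M) ≤ ‖z - g u‖ := by
        have h7 : ‖x - y‖ ≤ ‖z - g u‖ + ‖z - x‖ + ‖g u - w‖ + ‖y - w‖ := by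
          calc ‖x - y‖ = ‖(z - g u) - (z - x) + (g u - w) - (y - w)‖ := by congr 1; ring
            _ ≤ _ := (norm_sub_le _ _).trans (add_le_add_left ((norm_add_le _ _).trans
              (add_le_add_left (norm_sub_le _ _) _)) _)
        have h8 : 4 * ρ ≤ ‖x - y‖ * (4 / M) := by
          rw [mul_div_assoc', le_div_iff₀ hM0]
          linarith
        have h9 := hg u hu
        have h10 : ρ * u ≤ ρ := mul_le_of_le_one_right hρ.le hu.2
        rw [mul_sub, mul_one]
        linarith
      refine (shiftedKernel_anti D (by positivity) h6).trans ?_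
      rw [shiftedKernel_of_pos D (by positivity), Real.log_mul h0.ne' h4.ne', ← sub_sub,
        sub_eq_add_neg _ (Real.log (1 - 4 / M))]
      exact ENNReal.ofReal_add_le
    calc ∫⁻ u in Set.Icc (0 : ℝ) 1, shiftedKernel D ‖z - g u‖
        ≤ ∫⁻ u in Set.Icc (0 : ℝ) 1, (ENNReal.ofReal (Real.log D - Real.log ‖x - y‖) +
          ENNReal.ofReal (-Real.log (1 - 4 / M))) := setLIntegral_mono' measurableSet_Icc h5
      _ = _ := by rw [setLIntegral_const, Real.volume_Icc]; simp

instance isProbabilityMeasure_volume_restrict_Icc :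
    IsProbabilityMeasure (volume.restrict (Set.Icc (0 : ℝ) 1)) :=
  ⟨by simp⟩

/-- The image under `F` of the product of `ν` and the uniform distribution. -/
def spread (ν : Measure ℂ) (F : ℂ × ℝ → ℂ) : Measure ℂ :=
  (ν.prod (volume.restrict (Set.Icc (0 : ℝ) 1))).map F

theorem isProbabilityMeasure_spread {ν : Measure ℂ} [IsProbabilityMeasure ν] {F : ℂ × ℝ → ℂ}
    (hF : Measurable F) : IsProbabilityMeasure (spread ν F) :=
  Measure.isProbabilityMeasure_map hF.aemeasurable

theorem ae_prod_uniform {ν : Measure ℂ} [IsProbabilityMeasure ν] {G : Set ℂ}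
    (hG : ∀ᵐ x ∂ν, x ∈ G) :
    ∀ᵐ p ∂(ν.prod (volume.restrict (Set.Icc (0 : ℝ) 1))), p.1 ∈ G ∧ p.2 ∈ Set.Icc (0 : ℝ) 1 :=
  (Measure.quasiMeasurePreserving_fst.ae hG).and
    (Measure.quasiMeasurePreserving_snd.ae (ae_restrict_mem measurableSet_Icc))

theorem ae_spread {ν : Measure ℂ} [IsProbabilityMeasure ν] {F : ℂ × ℝ → ℂ} (hF : Measurable F)
    {G : Set ℂ} (hG : ∀ᵐ x ∂ν, x ∈ G) {S : Set ℂ} (hS : MeasurableSet S)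
    (h : ∀ x ∈ G, ∀ t ∈ Set.Icc (0 : ℝ) 1, F (x, t) ∈ S) : ∀ᵐ y ∂(spread ν F), y ∈ S := by
  rw [spread, ae_map_iff (p := (· ∈ S)) hF.aemeasurable hS]
  filter_upwards [ae_prod_uniform hG] with p hp
  exact h _ hp.1 _ hp.2

theorem lintegral_spread {ν : Measure ℂ} [IsProbabilityMeasure ν] {F : ℂ × ℝ → ℂ}
    (hF : Measurable F) {f : ℂ → ℝ≥0∞} (hf : Measurable f) :
    ∫⁻ y, f y ∂(spread ν F) = ∫⁻ x, (∫⁻ t in Set.Icc (0 : ℝ) 1, f (F (x, t))) ∂ν := by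
  rw [spread, lintegral_map hf hF]
  exact lintegral_prod _ (hf.comp hF).aemeasurable

/-- By Tonelli, the pointwise estimate is integrated over pairs. Averaging along the second curve
alone does the work; of the first it only matters that `F (x, t)` stays within `2 * ρ` of `x`. -/
theorem lintegral_shiftedKernel_spread_prod_le {ν : Measure ℂ} [IsProbabilityMeasure ν]
    {F : ℂ × ℝ → ℂ} (hF : Measurable F) {G : Set ℂ} (hG : ∀ᵐ x ∂ν, x ∈ G) {Z : ℂ → ℂ} {ρ M : ℝ}
    (hρ : 0 < ρ) (hM : 4 < M) (hZ : ∀ x ∈ G, ‖x - Z x‖ ≤ ρ)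
    (hFZ : ∀ x ∈ G, ∀ t ∈ Set.Icc (0 : ℝ) 1, ‖F (x, t) - Z x‖ = ρ * t) (D : ℝ) :
    ∫⁻ p, shiftedKernel D ‖p.1 - p.2‖ ∂((spread ν F).prod (spread ν F)) ≤
      ∫⁻ p, shiftedKernel D ‖p.1 - p.2‖ ∂(ν.prod ν) + ENNReal.ofReal (-Real.log (1 - 4 / M)) +
        nearConstant M * (ν.prod ν) {p : ℂ × ℂ | ‖p.1 - p.2‖ ≤ M * ρ} := by
  have := isProbabilityMeasure_spread (ν := ν) hF
  have hm : Measurable fun p : ℂ × ℂ => shiftedKernel D ‖p.1 - p.2‖ :=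
    (measurable_shiftedKernel D).comp (by fun_prop)
  have hS : MeasurableSet {p : ℂ × ℂ | ‖p.1 - p.2‖ ≤ M * ρ} :=
    measurableSet_le (by fun_prop) measurable_const
  let R : ℂ × ℂ → ℝ≥0∞ := fun p =>
    shiftedKernel D ‖p.1 - p.2‖ + ENNReal.ofReal (-Real.log (1 - 4 / M)) +
      {p : ℂ × ℂ | ‖p.1 - p.2‖ ≤ M * ρ}.indicator (fun _ => nearConstant M) p
  have hR : Measurable R := (hm.add_const _).add (measurable_const.indicator hS)
  have hRint : ∫⁻ p, R p ∂(ν.prod ν) = ∫⁻ p, shiftedKernel D ‖p.1 - p.2‖ ∂(ν.prod ν) +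
      ENNReal.ofReal (-Real.log (1 - 4 / M)) +
        nearConstant M * (ν.prod ν) {p : ℂ × ℂ | ‖p.1 - p.2‖ ≤ M * ρ} := by
    simp only [R]
    rw [lintegral_add_left (hm.add_const _), lintegral_add_left hm, lintegral_indicator_const hS]
    simp
  rw [← hRint, lintegral_prod _ hR.aemeasurable, lintegral_prod _ hm.aemeasurable,
    lintegral_spread hF hm.lintegral_prod_right']
  refine lintegral_mono_ae ?_
  filter_upwards [hG] with x hx
  calc ∫⁻ t in Set.Icc (0 : ℝ) 1, ∫⁻ y, shiftedKernel D ‖F (x, t) - y‖ ∂(spread ν F)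
      ≤ ∫⁻ _t in Set.Icc (0 : ℝ) 1, ∫⁻ y, R (x, y) ∂ν := by
        refine setLIntegral_mono' measurableSet_Icc fun t ht => ?_
        have hm' : Measurable fun y => shiftedKernel D ‖F (x, t) - y‖ :=
          (measurable_shiftedKernel D).comp (by fun_prop)
        rw [lintegral_spread hF hm']
        refine lintegral_mono_ae ?_
        filter_upwards [hG] with y hy
        refine lintegral_shiftedKernel_spread_le (g := fun u => F (y, u)) hρ hM (hFZ y hy) (hZ y hy)
          ?_ D
        calc ‖F (x, t) - x‖ = ‖(F (x, t) - Z x) - (x - Z x)‖ := by rw [sub_sub_sub_cancel_right]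
          _ ≤ ‖F (x, t) - Z x‖ + ‖x - Z x‖ := norm_sub_le _ _
          _ ≤ ρ + ρ := add_le_add ((hFZ x hx t ht).trans_le
              (mul_le_of_le_one_right hρ.le ht.2)) (hZ x hx)
          _ = 2 * ρ := by ring
    _ = _ := by rw [setLIntegral_const, Real.volume_Icc]; simp

theorem integral_spread_le {ν : Measure ℂ} [IsProbabilityMeasure ν] {F : ℂ × ℝ → ℂ}
    (hF : Measurable F) {G : Set ℂ} (hG : ∀ᵐ x ∂ν, x ∈ G) {φ : ℂ → ℝ} (hφ : Integrable φ ν)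
    (hφ' : Integrable φ (spread ν F)) {ε : ℝ}
    (h : ∀ x ∈ G, ∀ t ∈ Set.Icc (0 : ℝ) 1, φ (F (x, t)) ≤ φ x + ε) :
    ∫ y, φ y ∂(spread ν F) ≤ ∫ x, φ x ∂ν + ε := by
  have h1 : Integrable (fun p => φ (F p)) (ν.prod (volume.restrict (Set.Icc (0 : ℝ) 1))) :=
    (integrable_map_measure hφ'.aestronglyMeasurable hF.aemeasurable).1 hφ'
  have h2 : Integrable (fun p : ℂ × ℝ => φ p.1 + ε)
      (ν.prod (volume.restrict (Set.Icc (0 : ℝ) 1))) :=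
    (hφ.comp_fst _).add (integrable_const _)
  calc ∫ y, φ y ∂(spread ν F) = ∫ p, φ (F p) ∂(ν.prod (volume.restrict (Set.Icc (0 : ℝ) 1))) :=
        integral_map hF.aemeasurable hφ'.aestronglyMeasurable
    _ ≤ ∫ p, (φ p.1 + ε) ∂(ν.prod (volume.restrict (Set.Icc (0 : ℝ) 1))) := by
        refine integral_mono_ae h1 h2 ?_
        filter_upwards [ae_prod_uniform hG] with p hp
        exact h _ hp.1 _ hp.2
    _ = _ := by
        rw [integral_add (hφ.comp_fst _) (integrable_const _), integral_fun_fst]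
        simp

/-! ### A square grid -/

/-- The index of the square of side `τ` that contains `x`. -/
def gridCell (τ : ℝ) (x : ℂ) : ℤ × ℤ := (⌊x.re / τ⌋, ⌊x.im / τ⌋)

theorem measurable_gridCell (τ : ℝ) : Measurable (gridCell τ) :=
  Measurable.prodMk (Int.measurable_floor.comp (Complex.measurable_re.div_const τ))
    (Int.measurable_floor.comp (Complex.measurable_im.div_const τ))

theorem abs_sub_le_of_floor_div_eq {τ a b : ℝ} (hτ : 0 < τ) (h : ⌊a / τ⌋ = ⌊b / τ⌋) :
    |a - b| ≤ τ := by
  have h1 := (Int.abs_sub_lt_one_of_floor_eq_floor h).le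
  rwa [← sub_div, abs_div, abs_of_pos hτ, div_le_one hτ] at h1

theorem norm_sub_le_of_gridCell_eq {τ : ℝ} (hτ : 0 < τ) {x y : ℂ}
    (h : gridCell τ x = gridCell τ y) : ‖x - y‖ ≤ 2 * τ := by
  obtain ⟨h1, h2⟩ := Prod.ext_iff.1 h
  have h3 := abs_sub_le_of_floor_div_eq hτ h1
  have h4 := abs_sub_le_of_floor_div_eq hτ h2
  have h5 := Complex.norm_le_abs_re_add_abs_im (x - y)
  rw [Complex.sub_re, Complex.sub_im] at h5
  linarith

/-- Curves in `Γ` that start near `x` and depend measurably on `x`. -/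
theorem exists_measurable_curves {Γ : Set ExtendedPlane} (hΓ : IsClosed Γ) {ρ : ℝ} (hρ : 0 < ρ) :
    ∃ (H : Set ℂ) (F : ℂ × ℝ → ℂ) (Z : ℂ → ℂ), MeasurableSet H ∧ Measurable F ∧
      (∀ x, (∃ z, ‖x - z‖ ≤ ρ / 2 ∧ MeetsCircles Γ ρ z) → x ∈ H) ∧
      (∀ x ∈ H, ‖x - Z x‖ ≤ ρ) ∧
      ∀ x ∈ H, ∀ t ∈ Set.Icc (0 : ℝ) 1, ofComplex (F (x, t)) ∈ Γ ∧ ‖F (x, t) - Z x‖ = ρ * t := by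
  -- One curve is chosen per grid cell, so measurability in `x` only involves countably many
  -- choices. With side `ρ / 4`, points of a cell are within `ρ / 2`, which added to `ρ / 2` gives
  -- `ρ`.
  let I : Set (ℤ × ℤ) :=
    {n | ∃ x z, gridCell (ρ / 4) x = n ∧ ‖x - z‖ ≤ ρ / 2 ∧ MeetsCircles Γ ρ z}
  have key : ∀ n : ℤ × ℤ, ∃ (g : ℝ → ℂ) (z : ℂ), Measurable g ∧ (n ∈ I →
      (∀ x, gridCell (ρ / 4) x = n → ‖x - z‖ ≤ ρ) ∧
      ∀ t ∈ Set.Icc (0 : ℝ) 1, ofComplex (g t) ∈ Γ ∧ ‖g t - z‖ = ρ * t) := by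
    intro n
    by_cases hn : n ∈ I
    · obtain ⟨x, z, hx, hxz, hz⟩ := hn
      obtain ⟨g, hg, hg'⟩ := hz.exists_curve hΓ hρ.le
      refine ⟨g, z, hg, fun _ => ⟨fun y hy => ?_, hg'⟩⟩
      have h1 := norm_sub_le_of_gridCell_eq (by positivity) (hy.trans hx.symm)
      have h2 := norm_sub_le_norm_sub_add_norm_sub y x z
      linarith
    · exact ⟨fun _ => 0, 0, measurable_const, fun h => absurd h hn⟩
  choose g z hg hgz using key
  have hcell := measurable_gridCell (ρ / 4)
  have hF : Measurable fun q : (ℤ × ℤ) × ℝ => g q.1 q.2 := measurable_from_prod_countable_right hg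
  refine ⟨gridCell (ρ / 4) ⁻¹' I, fun p => g (gridCell (ρ / 4) p.1) p.2,
    fun x => z (gridCell (ρ / 4) x), hcell (Set.to_countable I).measurableSet,
    hF.comp ((hcell.comp measurable_fst).prodMk measurable_snd), ?_, ?_, ?_⟩
  · rintro x ⟨w, hw⟩
    exact ⟨x, w, rfl, hw⟩
  · exact fun x hx => (hgz _ hx).1 x rfl
  · exact fun x hx => (hgz _ hx).2

/-! ### Upper semicontinuity -/

theorem IsCompeting.weightedEnergy_eq {K : TopologicalSpace.NonemptyCompacts ExtendedPlane}
    {φ : ℂ → ℝ} {μ : Measure ℂ} (h : IsCompeting K φ μ) :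
    weightedEnergy φ μ =
      ((∫ p, realKernel p ∂(μ.prod μ) + 2 * ∫ x, φ x ∂μ : ℝ) : EReal) := by
  have := h.isProbabilityMeasure
  rw [weightedEnergy, logEnergy_eq_integral (prod_diagonal_eq_zero h.integrable_log h.energy_lt_top)
    (integrable_realKernel h.integrable_log h.energy_lt_top), EReal.coe_add]

/-- Comparison of the equilibrium energy with the energy of a measure that can be spread along
short curves in the compact set. -/
theorem equilibriumEnergy_le_of_curves {Γ : TopologicalSpace.NonemptyCompacts ExtendedPlane}
    {φ : ℂ → ℝ} {ν : Measure ℂ} [IsProbabilityMeasure ν]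
    (hd : (ν.prod ν) {p : ℂ × ℂ | p.1 = p.2} = 0) (hi : Integrable realKernel (ν.prod ν))
    (hφν : Integrable φ ν) {K : Set ℂ} (hK : IsCompact K) (hφ : ContinuousOn φ K)
    {G : Set ℂ} (hG : ∀ᵐ x ∂ν, x ∈ G) (hGK : G ⊆ K)
    {F : ℂ × ℝ → ℂ} (hF : Measurable F) {Z : ℂ → ℂ} {ρ M ε : ℝ} (hρ : 0 < ρ) (hM : 4 < M)
    (hZ : ∀ x ∈ G, ‖x - Z x‖ ≤ ρ)
    (hFZ : ∀ x ∈ G, ∀ t ∈ Set.Icc (0 : ℝ) 1, ofComplex (F (x, t)) ∈ Γ ∧ ‖F (x, t) - Z x‖ = ρ * t)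
    (hFK : ∀ x ∈ G, ∀ t ∈ Set.Icc (0 : ℝ) 1, F (x, t) ∈ K)
    (hφF : ∀ x ∈ G, ∀ t ∈ Set.Icc (0 : ℝ) 1, φ (F (x, t)) ≤ φ x + ε)
    (hε : 0 ≤ ε) (hfar : -Real.log (1 - 4 / M) ≤ ε)
    (hnear : nearConstant M * (ν.prod ν) {p : ℂ × ℂ | ‖p.1 - p.2‖ ≤ M * ρ} ≤ ENNReal.ofReal ε) :
    equilibriumEnergy φ Γ ≤
      ((∫ p, realKernel p ∂(ν.prod ν) + 2 * ∫ x, φ x ∂ν + 4 * ε : ℝ) : EReal) := by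
  have hprob := isProbabilityMeasure_spread (ν := ν) hF
  -- Both `ν` and its spread live on `K`, so `log D` makes the kernel nonnegative almost everywhere
  -- for each, and the truncation in `shiftedKernel` loses nothing.
  set D := Metric.diam K
  have hpair : ∀ {m : Measure ℂ} [IsProbabilityMeasure m], (∀ᵐ x ∂m, x ∈ K) →
      ∀ᵐ p ∂(m.prod m), ‖p.1 - p.2‖ ≤ D := by
    intro m _ hm
    filter_upwards [Measure.quasiMeasurePreserving_fst.ae hm,
      Measure.quasiMeasurePreserving_snd.ae hm] with p h1 h2
    rw [← dist_eq_norm]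
    exact Metric.dist_le_diam_of_mem hK.isBounded h1 h2
  have hνK : ∀ᵐ x ∂ν, x ∈ K := hG.mono fun x hx => hGK hx
  have hσK : ∀ᵐ x ∂(spread ν F), x ∈ K := ae_spread hF hG hK.measurableSet hFK
  obtain ⟨hν0, hνE⟩ := lintegral_shiftedKernel_eq hd hi (hpair hνK)
  have hle := lintegral_shiftedKernel_spread_prod_le hF hG hρ hM hZ
    (fun x hx t ht => (hFZ x hx t ht).2) D
  -- The far and near errors cost `ε` each; the field, counted twice, costs another `2 * ε`.
  have hle2 : ∫⁻ p, shiftedKernel D ‖p.1 - p.2‖ ∂((spread ν F).prod (spread ν F)) ≤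
      ENNReal.ofReal (∫ p, realKernel p ∂(ν.prod ν) + Real.log D + 2 * ε) := by
    refine hle.trans ?_
    rw [hνE, two_mul, ← add_assoc, ENNReal.ofReal_add (by positivity) hε,
      ENNReal.ofReal_add hν0 hε]
    gcongr
  obtain ⟨hσd, hσi⟩ := integrable_realKernel_of_shifted (hpair hσK)
    (hle2.trans_lt ENNReal.ofReal_lt_top)
  obtain ⟨hσ0, hσE⟩ := lintegral_shiftedKernel_eq hσd hσi (hpair hσK)
  rw [hσE, ENNReal.ofReal_le_ofReal_iff (by positivity)] at hle2
  have hres : (spread ν F).restrict K = spread ν F := Measure.restrict_eq_self_of_ae_mem hσK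
  have hint : ∀ f : ℂ → ℝ, ContinuousOn f K → Integrable f (spread ν F) := by
    intro f hf
    rw [← hres]
    exact hf.integrableOn_compact hK
  have hφσ := hint φ hφ
  have hfield := integral_spread_le hF hG hφν hφσ hφF
  have hcomp : IsCompeting Γ φ (spread ν F) :=
    { isProbabilityMeasure := hprob
      carried := ae_spread hF hG (S := ofComplex ⁻¹' Γ)
        (Γ.isCompact.isClosed.preimage continuous_ofComplex).measurableSet
        fun x hx t ht => (hFZ x hx t ht).1
      integrable_log := hint _ (Continuous.continuousOn
        (Continuous.log (by fun_prop) fun x => by positivity))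
      energy_lt_top := by
        rw [logEnergy_eq_integral hσd hσi]
        exact EReal.coe_lt_top _
      integrable_field := hφσ }
  refine (iInf₂_le _ hcomp).trans ?_
  rw [hcomp.weightedEnergy_eq, EReal.coe_le_coe_iff]
  linarith

theorem exists_far_constant {ε : ℝ} (hε : 0 < ε) : ∃ M : ℝ, 4 < M ∧ -Real.log (1 - 4 / M) ≤ ε := by
  have h1 : Tendsto (fun M : ℝ => -Real.log (1 - 4 / M)) atTop (𝓝 0) := by
    have h2 : Tendsto (fun M : ℝ => 1 - 4 / M) atTop (𝓝 1) := by
      simpa using tendsto_const_nhds.sub (tendsto_const_nhds (x := (4 : ℝ)).div_atTop tendsto_id)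
    simpa using (h2.log one_ne_zero).neg
  obtain ⟨M, h3, h4⟩ := ((eventually_gt_atTop 4).and (h1.eventually (gt_mem_nhds hε))).exists
  exact ⟨M, h3, h4.le⟩

/-- This makes the exceptional set `e` negligible, whatever the field does near it. -/
theorem noAtoms_of_prod_diagonal_eq_zero {μ : Measure ℂ} [SFinite μ]
    (hd : (μ.prod μ) {p : ℂ × ℂ | p.1 = p.2} = 0) : NullSingletonClass μ where
  measure_singleton x := by
    have h : (μ.prod μ) ({x} ×ˢ {x}) = 0 :=
      measure_mono_null (fun p hp => (hp.1 : p.1 = x).trans (hp.2 : p.2 = x).symm) hd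
    rwa [Measure.prod_prod, mul_self_eq_zero] at h

theorem prod_cond_le {μ : Measure ℂ} [IsProbabilityMeasure μ] {G : Set ℂ} (hG : 1 / 2 ≤ μ G)
    (S : Set (ℂ × ℂ)) : ((μ[|G]).prod (μ[|G])) S ≤ 4 * (μ.prod μ) S := by
  have h1 : (μ G)⁻¹ ≤ 2 := by
    rw [ENNReal.inv_le_iff_inv_le]
    simpa using hG
  rw [cond_prod_cond, Measure.smul_apply, smul_eq_mul]
  calc (μ G)⁻¹ * (μ G)⁻¹ * (μ.prod μ).restrict (G ×ˢ G) S ≤ 2 * 2 * (μ.prod μ) S := by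
        exact mul_le_mul' (mul_le_mul' h1 h1) (Measure.restrict_apply_le _ _)
    _ = _ := by norm_num

/-- A set that is close to `Γ` in the Hausdorff metric has points close to those of `Γ`. -/
theorem exists_near_of_dist_lt {Γ Γ' : TopologicalSpace.NonemptyCompacts ExtendedPlane} {R r : ℝ}
    (hr : 0 < r) (h : dist Γ' Γ < min 1 r / (2 * (1 + R ^ 2))) {x : ℂ} (hx : ofComplex x ∈ Γ)
    (hxR : ‖x‖ ≤ R) : ∃ z, ofComplex z ∈ Γ' ∧ ‖x - z‖ ≤ r := by
  rw [dist_comm, Metric.NonemptyCompacts.dist_eq] at h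
  obtain ⟨X, hX, hXx⟩ := Metric.exists_dist_lt_of_hausdorffDist_lt hx h
    (Metric.hausdorffEDist_ne_top_of_nonempty_of_bounded Γ.nonempty Γ'.nonempty
      Γ.isCompact.isBounded Γ'.isCompact.isBounded)
  rw [dist_comm] at hXx
  have hmono : 1 + ‖x‖ ^ 2 ≤ 1 + R ^ 2 := by gcongr
  -- The factor `2 * (1 + R ^ 2)` bounds the distortion between chordal and planar distance at
  -- points of modulus at most `R`; the `1` in the minimum keeps the nearby point away from `∞`.
  have hmain : 2 * (min 1 r / (2 * (1 + R ^ 2))) * (1 + ‖x‖ ^ 2) ≤ min 1 r := by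
    calc 2 * (min 1 r / (2 * (1 + R ^ 2))) * (1 + ‖x‖ ^ 2)
        ≤ 2 * (min 1 r / (2 * (1 + R ^ 2))) * (1 + R ^ 2) := by gcongr
      _ = min 1 r := by field_simp
  have hs : Real.sqrt (1 + ‖x‖ ^ 2) ≤ 1 + ‖x‖ ^ 2 := by
    have h1 := one_le_sqrt_one_add_sq x
    have h2 : Real.sqrt (1 + ‖x‖ ^ 2) ^ 2 = 1 + ‖x‖ ^ 2 := Real.sq_sqrt (by positivity)
    nlinarith
  obtain ⟨z, rfl, hz⟩ := exists_eq_ofComplex_of_dist_lt hXx (by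
    calc 2 * (min 1 r / (2 * (1 + R ^ 2))) * Real.sqrt (1 + ‖x‖ ^ 2)
        ≤ 2 * (min 1 r / (2 * (1 + R ^ 2))) * (1 + ‖x‖ ^ 2) := by gcongr
      _ ≤ 1 := hmain.trans (min_le_left _ _))
  refine ⟨z, hX, ?_⟩
  rw [norm_sub_rev]
  exact hz.trans (hmain.trans (min_le_right _ _))

end

theorem theorem3p2 (s : ℕ) (φ : ℂ → ℝ) (e : Set ℂ) (he : e.Finite) (hφ : ContinuousOn φ eᶜ)
    (𝒯 : Set (TopologicalSpace.NonemptyCompacts ExtendedPlane))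
    (h𝒯 : ∀ Γ ∈ 𝒯, numComponents Γ ≤ (s : ℕ∞)) :
    UpperSemicontinuousOn (equilibriumEnergy φ) 𝒯 := by
  intro Γ _ y hy
  obtain ⟨μ, hμy⟩ := iInf_lt_iff.1 hy
  obtain ⟨hμ, hμy⟩ := iInf_lt_iff.1 hμy
  have := hμ.isProbabilityMeasure
  have hd := prod_diagonal_eq_zero hμ.integrable_log hμ.energy_lt_top
  have hi := integrable_realKernel hμ.integrable_log hμ.energy_lt_top
  rw [hμ.weightedEnergy_eq] at hμy
  obtain ⟨c, hc, hcy⟩ := EReal.lt_iff_exists_real_btwn.1 hμy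
  rw [EReal.coe_lt_coe_iff] at hc
  obtain ⟨c', hc', hc'c⟩ := exists_between hc
  obtain ⟨ε₀, hε₀, hcond⟩ := exists_energy_cond_lt hi hμ.integrable_field hc'
  -- `equilibriumEnergy_le_of_curves` loses `4 * ε`, exactly the gap between `c'` and `c`.
  set ε := (c - c') / 4 with hεdef
  have hε : 0 < ε := by
    rw [hεdef]
    linarith
  -- a compact set of almost full measure on which the field is continuous
  have hatoms : NullSingletonClass μ := noAtoms_of_prod_diagonal_eq_zero hd
  obtain ⟨K, hKe, hK, hKμ⟩ : ∃ K ⊆ eᶜ, IsCompact K ∧ μ Kᶜ < ε₀ / 2 := by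
    obtain ⟨K, hKe, hK, hKμ⟩ := he.measurableSet.compl.exists_isCompact_sdiff_lt
      (measure_ne_top μ _) (ENNReal.half_pos hε₀.ne').ne'
    refine ⟨K, hKe, hK, lt_of_le_of_lt ?_ hKμ⟩
    calc μ Kᶜ ≤ μ (eᶜ \ K ∪ e) := measure_mono fun x hx => by
          by_cases h : x ∈ e
          · exact Or.inr h
          · exact Or.inl ⟨h, hx⟩
      _ ≤ μ (eᶜ \ K) + μ e := measure_union_le _ _
      _ = _ := by rw [he.measure_zero, add_zero]
  obtain ⟨δ₀, hδ₀, hKδ₀⟩ := hK.exists_cthickening_subset_open he.isClosed.isOpen_compl hKe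
  have hK' : IsCompact (Metric.cthickening δ₀ K) := hK.cthickening
  have hKK' : K ⊆ Metric.cthickening δ₀ K := Metric.self_subset_cthickening K
  have hφK' : ContinuousOn φ (Metric.cthickening δ₀ K) := hφ.mono hKδ₀
  obtain ⟨δ₁, hδ₁, hφδ₁⟩ := Metric.uniformContinuousOn_iff.1
    (hK'.uniformContinuousOn_of_continuous hφK') ε hε
  obtain ⟨R, hR⟩ := hK.isBounded.exists_norm_le
  obtain ⟨M, hM, hMε⟩ := exists_far_constant hε
  obtain ⟨η, hη, hηs⟩ : ∃ η : ℝ≥0∞, 0 < η ∧ s * η ≤ ε₀ / 2 := by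
    -- Dividing by `s + 1` avoids a separate case `s = 0`.
    refine ⟨ε₀ / 2 / (s + 1), ENNReal.div_pos (ENNReal.half_pos hε₀.ne').ne' (by finiteness), ?_⟩
    calc (s : ℝ≥0∞) * (ε₀ / 2 / (s + 1)) ≤ (s + 1) * (ε₀ / 2 / (s + 1)) := by
          gcongr
          exact le_self_add
      _ = ε₀ / 2 := ENNReal.mul_div_cancel (by simp) (by finiteness)
  -- The scale `ρ` is fixed before `Γ'` appears, so one Hausdorff ball around `Γ` serves all `Γ'`.
  -- The factor `4` anticipates conditioning on a set of mass at least `1 / 2`.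
  obtain ⟨ρ, ⟨⟨hρη, hρM⟩, hρδ₀, hρδ₁⟩, hρ⟩ : ∃ ρ : ℝ,
      (((μ.prod μ) {p : ℂ × ℂ | ‖p.1 - p.2‖ ≤ 3 * ρ} ≤ η * η ∧
      nearConstant M * (4 * (μ.prod μ) {p : ℂ × ℂ | ‖p.1 - p.2‖ ≤ M * ρ}) ≤ ENNReal.ofReal ε) ∧
      2 * ρ ≤ δ₀ ∧ 2 * ρ < δ₁) ∧ 0 < ρ := by
    have t1 := tendsto_measure_near_diagonal hd 3
    have t2 : Tendsto (fun ρ : ℝ => nearConstant M *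
        (4 * (μ.prod μ) {p : ℂ × ℂ | ‖p.1 - p.2‖ ≤ M * ρ})) (𝓝[>] 0) (𝓝 0) := by
      simpa using ENNReal.Tendsto.const_mul (ENNReal.Tendsto.const_mul
        (tendsto_measure_near_diagonal hd M) (Or.inr ENNReal.ofNat_ne_top))
        (Or.inr (nearConstant_lt_top M).ne)
    have t3 : Tendsto (fun ρ : ℝ => 2 * ρ) (𝓝[>] 0) (𝓝 0) := by
      simpa using (tendsto_nhdsWithin_of_tendsto_nhds (s := Set.Ioi 0)
        (tendsto_id (x := 𝓝 (0 : ℝ)))).const_mul 2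
    exact ((((t1.eventually_le_const (ENNReal.mul_pos hη.ne' hη.ne')).and
      (t2.eventually_le_const (ENNReal.ofReal_pos.2 hε))).and
      ((t3.eventually_le_const hδ₀).and (t3.eventually_lt_const hδ₁))).and
      self_mem_nhdsWithin).exists
  have hnhds : ∀ᶠ Γ' in 𝓝 Γ, dist Γ' Γ < min 1 (ρ / 2) / (2 * (1 + R ^ 2)) :=
    Metric.ball_mem_nhds _ (by positivity)
  filter_upwards [nhdsWithin_le_nhds hnhds, self_mem_nhdsWithin] with Γ' hΓ' hΓ'𝒯
  have hcard := h𝒯 Γ' hΓ'𝒯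
  rw [numComponents] at hcard
  have hfin : Finite (ConnectedComponents (Γ' : Set ExtendedPlane)) :=
    ENat.card_lt_top.1 (hcard.trans_lt (ENat.natCast_lt_top s))
  rw [ENat.card_eq_coe_natCard, Nat.cast_le] at hcard
  obtain ⟨H, F, Z, hH, hF, hmemH, hZ, hFZ⟩ := exists_measurable_curves Γ'.isCompact.isClosed hρ
  have hGm : MeasurableSet (K ∩ H) := hK.measurableSet.inter hH
  have hGμ : μ (K ∩ H)ᶜ < ε₀ := by
    -- A point is lost only if it is outside `K`, near a bad point of `Γ'`, or outside `Γ`; the last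
    -- set is null. The first two cost at most `ε₀ / 2` each.
    have hsub : (K ∩ H)ᶜ ⊆ (Kᶜ ∪ {x | ∃ z, ExtendedPlane.ofComplex z ∈ (Γ' : Set ExtendedPlane) ∧
        ‖x - z‖ ≤ ρ ∧ ¬ MeetsCircles Γ' ρ z}) ∪ {x | ¬ ExtendedPlane.ofComplex x ∈ Γ} := by
      intro x hx
      by_cases hxK : x ∈ K
      · by_cases hxΓ : ExtendedPlane.ofComplex x ∈ Γ
        · obtain ⟨z, hz, hxz⟩ := exists_near_of_dist_lt (by positivity) hΓ' hxΓ (hR x hxK)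
          refine Or.inl (Or.inr ⟨z, hz, by linarith, fun hzm => hx ⟨hxK, hmemH x ⟨z, hxz, hzm⟩⟩⟩)
        · exact Or.inr hxΓ
      · exact Or.inl (Or.inl hxK)
    calc μ (K ∩ H)ᶜ ≤ _ := measure_mono hsub
      _ ≤ _ := measure_union_le _ _
      _ ≤ _ := add_le_add_left (measure_union_le _ _) _
      _ = _ := by rw [ae_iff.1 hμ.carried, add_zero]
      _ < ε₀ / 2 + ε₀ / 2 := by
        refine ENNReal.add_lt_add_of_lt_of_le ?_ hKμ ?_
        · exact measure_ne_top _ _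
        · refine (measure_near_not_meetsCircles_le hρη).trans (le_trans ?_ hηs)
          gcongr
      _ = ε₀ := ENNReal.add_halves ε₀
  obtain ⟨hhalf, hlt⟩ := hcond _ hGm hGμ
  have hG0 : μ (K ∩ H) ≠ 0 := fun h => by simp [h] at hhalf
  have hprob : IsProbabilityMeasure (μ[|K ∩ H]) := ProbabilityTheory.cond_isProbabilityMeasure hG0
  have hFx : ∀ x ∈ K ∩ H, ∀ t ∈ Set.Icc (0 : ℝ) 1, ‖F (x, t) - x‖ ≤ 2 * ρ := by
    intro x hx t ht
    have h1 := (hFZ x hx.2 t ht).2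
    have h2 := norm_sub_le_norm_sub_add_norm_sub (F (x, t)) (Z x) x
    have h3 := hZ x hx.2
    rw [norm_sub_rev] at h3
    have h4 : ρ * t ≤ ρ := mul_le_of_le_one_right hρ.le ht.2
    linarith
  have hFK : ∀ x ∈ K ∩ H, ∀ t ∈ Set.Icc (0 : ℝ) 1, F (x, t) ∈ Metric.cthickening δ₀ K := by
    intro x hx t ht
    refine Metric.mem_cthickening_of_dist_le _ x _ _ hx.1 ?_
    rw [dist_eq_norm]
    exact (hFx x hx t ht).trans hρδ₀
  refine lt_of_le_of_lt (equilibriumEnergy_le_of_curves (ν := μ[|K ∩ H]) (G := K ∩ H) (ε := ε)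
    (nonpos_iff_eq_zero.1 ((prod_cond_le hhalf _).trans (by rw [hd, mul_zero]))) ?_ ?_ hK' hφK'
    (ProbabilityTheory.ae_cond_mem hGm) (fun x hx => hKK' hx.1) hF hρ hM (fun x hx => hZ x hx.2)
    (fun x hx => hFZ x hx.2) hFK (fun x hx t ht => ?_) hε.le hMε ?_) (lt_trans ?_ hcy)
  · rw [cond_prod_cond]
    exact hi.restrict.smul_measure (ENNReal.mul_ne_top (by simpa using hG0) (by simpa using hG0))
  · exact hμ.integrable_field.restrict.smul_measure (by simpa using hG0)
  · have h1 := hφδ₁ _ (hFK x hx t ht) _ (hKK' hx.1)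
      (by rw [dist_eq_norm]; exact (hFx x hx t ht).trans_lt hρδ₁)
    rw [Real.dist_eq] at h1
    linarith [le_abs_self (φ (F (x, t)) - φ x)]
  · exact (mul_le_mul_right (prod_cond_le hhalf _) _).trans hρM
  · rw [EReal.coe_lt_coe_iff]
    linarith
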